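/- Let $p\equiv 1\pmod 4$ be a prime, $p=4R+1$, let $g$ be a primitive root modulo $p$, and for $k=0,1,2,3$ let $H_k=\{g^{k+4t} \bmod p : t=0,\dots,R-1\}$ be the cyclotomic classes of order four. For $k\in\{0,1\}$ and $l\in\{0,1,2,3\}$ put $$H_{k,l}=\{w\in\mathbb Z_{2p} : w \bmod 2 = k,\ w \bmod p\in H_l\},$$ and let $s$ be the quaternary sequence of period $2p$ given by $$s(t)=\begin{cases}0,& t \bmod 2p\in\{0\}\cup H_{0,0}\cup H_{1,2},\\ 1,& t \bmod 2p\in H_{0,2}\cup H_{1,0},\\ 2,& t \bmod 2p\in\{p\}\cup H_{0,1}\cup H_{1,3},\\ 3,& t \bmod 2p\in H_{0,3}\cup H_{1,1}.\end{cases}$$ For an integer $w$ let $R(w)=\sum_{n=0}^{2p-1} i^{\,s(n)-s(n+w)}$ be its periodic autocorrelation, where $i=\sqrt{-1}$. Write $p=x^2+4y^2$ with $x,y\in\mathbb Z$ and $x\equiv 1\pmod 4$. Then (i) if $p\equiv 5\pmod 8$, then $\max_{1\le w\le 2p-1}|R(w)|=\max|-2\pm 2y\pm 2i|$; (ii) if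 $p\equiv 1\pmod 8$, then $\max_{1\le w\le 2p-1}|R(w)|=\max|-4\pm 2y|$, where the maxima on the right-hand sides are taken over all choices of signs. -/

import Mathlib

namespace QuaternaryCyclotomic

/-- The cyclotomic class `H_k = {g ^ (k + 4 t) mod p : t = 0, ..., R - 1}` of order four, where
`p = 4 R + 1` and `g` is a primitive root modulo `p`. -/
def cycClass (p : ℕ) (g : ZMod p) (k : Fin 4) : Finset (ZMod p) :=
  (Finset.range ((p - 1) / 4)).image fun t => g ^ ((k : ℕ) + 4 * t)

/-- The set `H_{k,l} = f⁻¹({k} × H_l)`, where `f : ℤ/2p → ℤ/2 × ℤ/p` is reduction in both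
coordinates. -/
def cycClass₂ (p : ℕ) (g : ZMod p) (k : ZMod 2) (l : Fin 4) : Set (ZMod (2 * p)) :=
  {w | ZMod.castHom (dvd_mul_right 2 p) (ZMod 2) w = k ∧
    ZMod.castHom (dvd_mul_left p 2) (ZMod p) w ∈ cycClass p g l}

/-- The set `C_k = H_{0, j_k} ∪ H_{1, l_k}`. -/
def classC (p : ℕ) (g : ZMod p) (j l : Fin 4 → Fin 4) (k : Fin 4) : Set (ZMod (2 * p)) :=
  cycClass₂ p g 0 (j k) ∪ cycClass₂ p g 1 (l k)

open scoped Classical in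
/-- The quaternary sequence `s` attached to `(j_k)` and `(l_k)`: `s(t) = k` if `t mod 2p ∈ C_k`,
`s(t) = 0` if `t mod 2p = 0`, and `s(t) = 2` if `t mod 2p = p`. If `p = 4 R + 1` is prime, `g` is a
primitive root and `j`, `l` are injective, then the six cases are disjoint and exhaustive, so
neither their order nor the value in the last branch matters. -/
noncomputable def quatSeq (p : ℕ) (g : ZMod p) (j l : Fin 4 → Fin 4) (t : ℕ) : ℤ :=
  if (t : ZMod (2 * p)) = 0 then 0
  else if (t : ZMod (2 * p)) = (p : ZMod (2 * p)) then 2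
  else if (t : ZMod (2 * p)) ∈ classC p g j l 0 then 0
  else if (t : ZMod (2 * p)) ∈ classC p g j l 1 then 1
  else if (t : ZMod (2 * p)) ∈ classC p g j l 2 then 2
  else if (t : ZMod (2 * p)) ∈ classC p g j l 3 then 3
  else 0

/-- The periodic autocorrelation `R(w) = ∑_{n = 0}^{N - 1} i ^ (s(n) - s(n + w))` of a quaternary
sequence `s` of period `N`. -/
noncomputable def autocorr (N : ℕ) (s : ℕ → ℤ) (w : ℕ) : ℂ :=
  ∑ n ∈ Finset.range N, Complex.I ^ (s n - s (n + w))

/-- The set of magnitudes `|R(w)|`, `w = 1, ..., N - 1`. -/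
def nontrivialMagnitudes (N : ℕ) (s : ℕ → ℤ) : Set ℝ :=
  {r | ∃ w : ℕ, 0 < w ∧ w < N ∧ r = ‖autocorr N s w‖}

end QuaternaryCyclotomic

namespace QuaternaryCyclotomic

open Complex Finset

/-! Let `χ` be the quartic character with `χ g = I`. The Chinese remainder theorem splits an index
into a parity `a` and a residue `v`. The sequence becomes `phase`, a multiple of `χ²` plus `sgn a`
times a combination of `χ`, `χ⁻¹` and a point mass at `0` (`I_zpow_quatSeq`). Summing over `a` kills
the mixed terms, so `R(w)` is a sum of correlations of characters, each a Jacobi sum. All are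
trivial except `J(χ, χ)` and its conjugate, which contribute through `Im J(χ, χ)`
(`autocorr_of_coe_ne_zero`).

Now `J(χ, χ) = a - 2mi` with `a` odd and `a² + 4m² = p`, and uniqueness of this representation gives
`m = ±y`. What remains is a table over `χ w`, `sgn w` and `χ (-1)`, where `χ (-1)` is `-1` or `1` as
`p` is `5` or `1` mod `8`. Even shifts attain the extreme values with both signs of `y`; the shift
`p` gives only `-2`. -/

/-! ### Gaussian integers and sums of two squares. -/

theorem isPrimitiveRoot_I : IsPrimitiveRoot I 4 := by
  refine IsPrimitiveRoot.mk_of_lt I (by norm_num) I_pow_four fun l h0 h4 => ?_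
  interval_cases l <;> norm_num [Complex.ext_iff, pow_succ]

/-- In `ℤ`, the even part of a representation of a prime as a sum of two squares is unique. -/
theorem even_sq_eq_of_sum_two_squares {p : ℕ} (hp : p.Prime) {a b x z : ℤ}
    (h₁ : (p : ℤ) = a ^ 2 + b ^ 2) (h₂ : (p : ℤ) = x ^ 2 + z ^ 2)
    (ha : Odd a) (hx : Odd x) (hb : Even b) : z ^ 2 = b ^ 2 := by
  have hp0 : (0 : ℤ) < p := by exact_mod_cast hp.pos
  have key : (a * z - b * x) * (a * z + b * x) = p * (z ^ 2 - b ^ 2) := by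
    have h₁' : a ^ 2 = p - b ^ 2 := by linarith
    have h₂' : x ^ 2 = p - z ^ 2 := by linarith
    linear_combination z ^ 2 * h₁' - b ^ 2 * h₂'
  -- By the two-square identity `(ax - b'z)² + (az + b'x)² = p²`, whose first term is odd, hence
  -- nonzero, a multiple of `p` in the second can only be `0`. Both signs of `b` are needed below.
  have zero_of_dvd : ∀ b' : ℤ, Even b' → (p : ℤ) = a ^ 2 + b' ^ 2 → (p : ℤ) ∣ a * z + b' * x →
      a * z + b' * x = 0 := by
    rintro b' hb' h ⟨k, hk⟩
    have hsq : (a * x - b' * z) ^ 2 + (a * z + b' * x) ^ 2 = (p : ℤ) ^ 2 := by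
      linear_combination (-(p : ℤ)) * h - (a ^ 2 + b' ^ 2) * h₂
    have hne : a * x - b' * z ≠ 0 := by
      have : Odd (a * x - b' * z) := (ha.mul hx).sub_even (hb'.mul_right z)
      rintro h0
      simp [h0] at this
    have hpos : 0 < (a * x - b' * z) ^ 2 := by positivity
    rw [hk] at hsq
    have hk1 : k ^ 2 < 1 := by
      by_contra! hk1
      nlinarith [mul_le_mul_of_nonneg_left hk1 (sq_nonneg (p : ℤ))]
    have : k = 0 := by nlinarith [sq_nonneg k, sq_eq_zero_iff.mp (le_antisymm (by lia) (sq_nonneg k))]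
    rw [hk, this, mul_zero]
  have hprod : (a * z - b * x) * (a * z + b * x) = 0 := by
    rcases (Nat.prime_iff_prime_int.mp hp).dvd_or_dvd (Dvd.intro _ key.symm) with h | h
    · have := zero_of_dvd (-b) hb.neg (by linarith) (by simpa [sub_eq_add_neg] using h)
      rw [show a * z - b * x = a * z + -b * x by ring, this, zero_mul]
    · rw [zero_of_dvd b hb h₁ h, mul_zero]
  rw [key] at hprod
  have := (mul_eq_zero.mp hprod).resolve_left hp0.ne'
  linarith

theorem exists_of_mem_adjoin_I {z : ℂ} (hz : z ∈ Algebra.adjoin ℤ {I}) :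
    ∃ m n : ℤ, z = m + n * I := by
  induction hz using Algebra.adjoin_induction with
  | mem x hx => exact ⟨0, 1, by simpa using hx⟩
  | algebraMap r => exact ⟨r, 0, by simp⟩
  | add x y _ _ hx hy =>
    obtain ⟨a, b, rfl⟩ := hx
    obtain ⟨c, d, rfl⟩ := hy
    exact ⟨a + c, b + d, by push_cast; ring⟩
  | mul x y _ _ hx hy =>
    obtain ⟨a, b, rfl⟩ := hx
    obtain ⟨c, d, rfl⟩ := hy
    refine ⟨a * c - b * d, a * d + b * c, ?_⟩
    push_cast
    linear_combination (b * d : ℂ) * I_sq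

/-! ### Correlations of characters and the quartic Jacobi sum. -/

section Character

variable {F : Type*} [Field F]

/-- The cross-correlation of two multiplicative characters is a Jacobi sum. -/
theorem sum_mul_shift [Fintype F] (φ ψ : MulChar F ℂ) {u : F} (hu : u ≠ 0) :
    ∑ v, φ v * ψ (v + u) = φ (-1) * (φ u * ψ u) * jacobiSum φ ψ := by
  -- Substitute `v = -u s`, so that `v + u = u (1 - s)`.
  rw [jacobiSum, mul_sum, ← Equiv.sum_comp (Equiv.mulLeft₀ (-u) (neg_ne_zero.mpr hu))]
  refine sum_congr rfl fun s _ => ?_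
  simp only [Equiv.mulLeft₀_apply]
  rw [show -u * s + u = u * (1 - s) by ring,
    show -u * s = -1 * u * s by ring]
  simp only [map_mul]
  ring

theorem apply_neg_one_mul_self (φ : MulChar F ℂ) : φ (-1) * φ (-1) = 1 := by
  rw [← map_mul]; simp

theorem apply_mul_inv_apply (φ : MulChar F ℂ) {u : F} (hu : u ≠ 0) : φ u * φ⁻¹ u = 1 := by
  rw [← MulChar.mul_apply, mul_inv_cancel, MulChar.one_apply hu.isUnit]

theorem sum_mul_inv_shift [Fintype F] {φ : MulChar F ℂ} (hφ : φ ≠ 1) {u : F} (hu : u ≠ 0) :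
    ∑ v, φ v * φ⁻¹ (v + u) = -1 := by
  rw [sum_mul_shift φ _ hu, jacobiSum_nontrivial_inv hφ, apply_mul_inv_apply φ hu]
  linear_combination -apply_neg_one_mul_self φ

theorem conj_jacobiSum [Fintype F] (χ : MulChar F ℂ) :
    jacobiSum χ⁻¹ χ⁻¹ = starRingEnd ℂ (jacobiSum χ χ) := by
  rw [← MulChar.star_eq_inv]
  exact jacobiSum_ringHomComp χ χ (starRingEnd ℂ)

theorem sq_ne_one_of_orderOf {χ : MulChar F ℂ} (h4 : orderOf χ = 4) : χ ^ 2 ≠ 1 := fun h => by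
  have := orderOf_dvd_of_pow_eq_one h
  rw [h4] at this
  norm_num at this

theorem ne_one_of_orderOf {χ : MulChar F ℂ} (h4 : orderOf χ = 4) : χ ≠ 1 := fun h => sq_ne_one_of_orderOf h4 (by rw [h, one_pow])

theorem sq_inv_of_orderOf {χ : MulChar F ℂ} (h4 : orderOf χ = 4) : (χ ^ 2)⁻¹ = χ ^ 2 := by
  rw [inv_eq_iff_mul_eq_one, ← pow_add, show 2 + 2 = orderOf χ from h4.symm, pow_orderOf_eq_one]

/-- The Jacobi sum of a quartic character with itself. -/
theorem exists_jacobiSum_quartic [Fintype F] {χ : MulChar F ℂ} (h4 : orderOf χ = 4)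
    (hF : ringChar F ≠ 0) :
    ∃ a m : ℤ, jacobiSum χ χ = a - 2 * m * I ∧ Odd a ∧
      (Fintype.card F : ℤ) = a ^ 2 + (2 * m) ^ 2 := by
  have hχ : χ ^ 4 = 1 := by rw [← h4, pow_orderOf_eq_one]
  -- `J = -1 + z (i - 1)²` with `z` in `ℤ[i]`; since `(i - 1)² = -2i`, the real part is odd and the
  -- imaginary part even.
  obtain ⟨z, hz, hJ⟩ := exists_jacobiSum_eq_neg_one_add (by norm_num) hχ hχ
    (h4 ▸ χ.orderOf_dvd_card_sub_one) isPrimitiveRoot_I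
  obtain ⟨m, n, rfl⟩ := exists_of_mem_adjoin_I hz
  have hJ' : jacobiSum χ χ = ((2 * n - 1 : ℤ) : ℂ) - 2 * m * I := by
    rw [hJ]
    push_cast
    linear_combination (m + n * I - 2 * n : ℂ) * I_sq
  refine ⟨2 * n - 1, m, hJ', ⟨n - 1, by ring⟩, ?_⟩
  have hnorm := jacobiSum_mul_jacobiSum_inv (F := F) (F' := ℂ) (χ := χ) (φ := χ)
    (by rw [ringChar.eq_zero]; exact hF.symm) (ne_one_of_orderOf h4) (ne_one_of_orderOf h4)
    (by rw [← sq]; exact sq_ne_one_of_orderOf h4)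
  rw [conj_jacobiSum, hJ'] at hnorm
  have : ((Fintype.card F : ℤ) : ℂ) = (((2 * n - 1) ^ 2 + (2 * m) ^ 2 : ℤ) : ℂ) := by
    rw [Int.cast_natCast, ← hnorm]
    simp only [map_sub, map_mul, conj_I, map_intCast, map_ofNat]
    push_cast
    linear_combination (-4 * m ^ 2 : ℂ) * I_sq
  exact_mod_cast this

end Character

/-! ### The sequence in terms of `χ`, and its autocorrelation. -/

section Cyclotomic

variable {p : ℕ} {g : ZMod p}

theorem sq_apply (χ : MulChar (ZMod p) ℂ) (v : ZMod p) : (χ ^ 2) v = χ v ^ 2 :=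
  MulChar.pow_apply' χ two_ne_zero v

theorem inv_apply_of_eq_I_pow {χ : MulChar (ZMod p) ℂ} {v : ZMod p} {c : Fin 4} (hv : χ v = I ^ (c : ℕ)) :
    χ⁻¹ v = (-I) ^ (c : ℕ) := by
  rw [← MulChar.star_apply', hv, RCLike.star_def, map_pow, conj_I]

variable [Fact p.Prime]

theorem exists_quartic_character (hg : IsPrimitiveRoot g (p - 1)) (hp4 : 4 ∣ p - 1) :
    ∃ χ : MulChar (ZMod p) ℂ, χ g = I ∧ orderOf χ = 4 := by
  have hp1 : p - 1 ≠ 0 := (Nat.sub_pos_of_lt (Fact.out : p.Prime).one_lt).ne'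
  obtain ⟨G, rfl⟩ := hg.isUnit hp1
  have hG : ∀ x, x ∈ Subgroup.zpowers G := by
    have hord : orderOf G = p - 1 := (IsPrimitiveRoot.coe_units_iff.mp hg).eq_orderOf.symm
    have htop : Subgroup.zpowers G = ⊤ := by
      apply Subgroup.eq_top_of_card_eq
      rw [Nat.card_zpowers, hord, Nat.card_eq_fintype_card, ZMod.card_units]
    simp [htop]
  have hI : Units.mk0 I I_ne_zero ∈ rootsOfUnity (Fintype.card (ZMod p)ˣ) ℂ := by
    obtain ⟨R, hR⟩ := hp4
    rw [_root_.mem_rootsOfUnity, ZMod.card_units, hR, pow_mul]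
    have : Units.mk0 I I_ne_zero ^ 4 = 1 := Units.ext (by simp)
    rw [this, one_pow]
  let χ := MulChar.ofRootOfUnity hI hG
  have hχ : χ G = I := MulChar.ofRootOfUnity_spec hI hG
  refine ⟨χ, hχ, ?_⟩
  have h2 : ¬ χ ^ 2 ^ 1 = 1 := by
    rw [MulChar.eq_iff hG, MulChar.pow_apply_coe, hχ, MulChar.one_apply_coe]
    norm_num
  have h4 : χ ^ 2 ^ (1 + 1) = 1 := by
    rw [MulChar.eq_iff hG, MulChar.pow_apply_coe, hχ, MulChar.one_apply_coe]
    norm_num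
  exact orderOf_eq_prime_pow h2 h4

variable {χ : MulChar (ZMod p) ℂ}

theorem exists_apply_eq_I_pow (hg : IsPrimitiveRoot g (p - 1)) (hχ : χ g = I) {v : ZMod p}
    (hv : v ≠ 0) : ∃ c : Fin 4, χ v = I ^ (c : ℕ) := by
  have : NeZero (p - 1) := ⟨(Nat.sub_pos_of_lt (Fact.out : p.Prime).one_lt).ne'⟩
  obtain ⟨m, -, rfl⟩ := hg.eq_pow_of_pow_eq_one (ZMod.pow_card_sub_one_eq_one hv)
  refine ⟨⟨m % 4, Nat.mod_lt _ (by norm_num)⟩, ?_⟩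
  rw [map_pow, hχ]
  rw [← pow_mod_orderOf I m, ← isPrimitiveRoot_I.eq_orderOf]

theorem mem_cycClass_iff (hg : IsPrimitiveRoot g (p - 1)) (hp4 : 4 ∣ p - 1) (hχ : χ g = I)
    {v : ZMod p} {c : Fin 4} (hv : χ v = I ^ (c : ℕ)) (l : Fin 4) :
    v ∈ cycClass p g l ↔ c = l := by
  have hp1 : NeZero (p - 1) := ⟨(Nat.sub_pos_of_lt (Fact.out : p.Prime).one_lt).ne'⟩
  rw [cycClass, mem_image]
  constructor
  · rintro ⟨t, -, rfl⟩
    rw [map_pow, hχ, pow_add, pow_mul, I_pow_four, one_pow, mul_one] at hv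
    exact Fin.ext (isPrimitiveRoot_I.pow_inj l.2 c.2 hv).symm
  · rintro rfl
    have hv0 : v ≠ 0 := by
      rintro rfl
      rw [MulChar.map_zero] at hv
      exact pow_ne_zero _ I_ne_zero hv.symm
    obtain ⟨m, hm, rfl⟩ := hg.eq_pow_of_pow_eq_one (ZMod.pow_card_sub_one_eq_one hv0)
    rw [map_pow, hχ] at hv
    have hmod : m % 4 = c := by
      refine isPrimitiveRoot_I.pow_inj (Nat.mod_lt _ (by norm_num)) c.2 ?_
      rw [← hv, ← pow_mod_orderOf I m, ← isPrimitiveRoot_I.eq_orderOf]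
    refine ⟨m / 4, mem_range.mpr ?_, by rw [← hmod, Nat.mod_add_div]⟩
    omega

/-- The sign `(-1) ^ a` for `a : ℤ/2`. -/
def sgn (a : ZMod 2) : ℂ := if a = 0 then 1 else -1

open scoped Classical in
/-- The complex value of the quaternary sequence at the point with residues `(a, v)`, expanded
in powers of the quartic character. -/
noncomputable def phase (χ : MulChar (ZMod p) ℂ) (a : ZMod 2) (v : ZMod p) : ℂ :=
  (1 + I) / 2 * (χ ^ 2) v + sgn a * ((χ v - I * χ⁻¹ v) / 2 + if v = 0 then 1 else 0)

theorem natCast_eq_iff_of_coprime {m k : ℕ} (h : m.Coprime k) (a b : ℕ) :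
    (a : ZMod (m * k)) = b ↔ (a : ZMod m) = b ∧ (a : ZMod k) = b := by
  simp only [ZMod.natCast_eq_natCast_iff]
  exact (Nat.modEq_and_modEq_iff_modEq_mul h).symm

theorem coprime_two_of_dvd (hp4 : 4 ∣ p - 1) : Nat.Coprime 2 p := by
  have := (Fact.out : p.Prime).one_lt
  rw [Nat.coprime_two_left, Nat.odd_iff]
  omega

theorem natCast_zmod_two_eq_one (hp4 : 4 ∣ p - 1) : (p : ZMod 2) = 1 :=
  (ZMod.natCast_eq_one_iff_odd).mpr (Nat.coprime_two_left.mp (coprime_two_of_dvd hp4))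

theorem I_zpow_quatSeq (hg : IsPrimitiveRoot g (p - 1)) (hp4 : 4 ∣ p - 1) (hχ : χ g = I)
    (n : ℕ) : I ^ quatSeq p g ![0, 2, 1, 3] ![2, 0, 3, 1] n = phase χ (n : ZMod 2) (n : ZMod p) := by
  have hcop := coprime_two_of_dvd hp4
  have h0 : (n : ZMod (2 * p)) = 0 ↔ (n : ZMod 2) = 0 ∧ (n : ZMod p) = 0 := by
    simpa using natCast_eq_iff_of_coprime hcop n 0
  have h1 : (n : ZMod (2 * p)) = (p : ZMod (2 * p)) ↔ (n : ZMod 2) = 1 ∧ (n : ZMod p) = 0 := by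
    simpa [natCast_zmod_two_eq_one hp4] using natCast_eq_iff_of_coprime hcop n p
  rw [quatSeq]
  simp only [h0, h1, classC, cycClass₂, Set.mem_union, Set.mem_ofPred_eq, map_natCast]
  generalize (n : ZMod 2) = a
  generalize (n : ZMod p) = v
  have ha : a = 0 ∨ a = 1 := by revert a; decide
  by_cases hv : v = 0
  · subst hv
    rcases ha with rfl | rfl <;> simp [phase, sgn, MulChar.map_zero]
  · obtain ⟨c, hc⟩ := exists_apply_eq_I_pow hg hχ hv
    simp only [mem_cycClass_iff hg hp4 hχ hc, phase, sgn, inv_apply_of_eq_I_pow hc, hc, hv,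
      sq_apply]
    rcases ha with rfl | rfl <;> fin_cases c <;>
      simp [Complex.ext_iff, pow_succ, zpow_ofNat] <;> norm_num

/-- Conjugation swaps `χ` and `χ⁻¹`, which multiplies `χ - I χ⁻¹` by `I`. -/
theorem conj_phase (h4 : orderOf χ = 4) (a : ZMod 2) (v : ZMod p) :
    starRingEnd ℂ (phase χ a v) =
      (1 - I) / 2 * (χ ^ 2) v +
        sgn a * (I * ((χ v - I * χ⁻¹ v) / 2) + if v = 0 then 1 else 0) := by
  have h1 : starRingEnd ℂ (χ v) = χ⁻¹ v := MulChar.star_apply' χ v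
  have h2 : starRingEnd ℂ (χ⁻¹ v) = χ v := by rw [← h1, conj_conj]
  have h3 : starRingEnd ℂ ((χ ^ 2) v) = (χ ^ 2) v := by
    have := MulChar.star_apply' (χ ^ 2) v
    rwa [sq_inv_of_orderOf h4] at this
  have h5 : starRingEnd ℂ (2 : ℂ) = 2 := map_ofNat _ 2
  rw [phase, sgn]
  split_ifs <;> simp [h1, h2, h3, h5]
  · linear_combination (χ⁻¹ v / 2) * I_sq
  · linear_combination (χ⁻¹ v / 2) * I_sq
  · linear_combination (-χ⁻¹ v / 2) * I_sq
  · linear_combination (-χ⁻¹ v / 2) * I_sq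

theorem sum_range_two_mul {M : Type*} [AddCommMonoid M] (hcop : Nat.Coprime 2 p)
    (f : ZMod 2 → ZMod p → M) :
    ∑ n ∈ range (2 * p), f n n = ∑ v, (f 0 v + f 1 v) := by
  have h2 : NeZero (2 * p) := ⟨by simp [(Fact.out : p.Prime).ne_zero]⟩
  have hp : ∑ v, (f 0 v + f 1 v) = ∑ x : ZMod 2 × ZMod p, f x.1 x.2 := by
    rw [Fintype.sum_prod_type, sum_add_distrib]
    exact (Fin.sum_univ_two fun a : ZMod 2 => ∑ v, f a v).symm
  rw [hp, ← (ZMod.chineseRemainder hcop).toEquiv.sum_comp]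
  refine sum_bij (fun n _ => (n : ZMod (2 * p))) (fun _ _ => mem_univ _) ?_ ?_ ?_
  · intro a ha b hb hab
    rw [ZMod.natCast_eq_natCast_iff] at hab
    exact hab.eq_of_lt_of_lt (mem_range.mp ha) (mem_range.mp hb)
  · intro b _
    exact ⟨b.val, mem_range.mpr b.val_lt, ZMod.natCast_zmod_val b⟩
  · intro n _
    simp

theorem autocorr_eq_sum (hg : IsPrimitiveRoot g (p - 1)) (hp4 : 4 ∣ p - 1) (hχ : χ g = I)
    (w : ℕ) :
    autocorr (2 * p) (quatSeq p g ![0, 2, 1, 3] ![2, 0, 3, 1]) w =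
      ∑ v, (phase χ 0 v * starRingEnd ℂ (phase χ w (v + w)) +
        phase χ 1 v * starRingEnd ℂ (phase χ (1 + w) (v + w))) := by
  rw [autocorr]
  have key := sum_range_two_mul (coprime_two_of_dvd hp4)
    fun a v => phase χ a v * starRingEnd ℂ (phase χ (a + w) (v + w))
  rw [zero_add] at key
  rw [← key]
  refine sum_congr rfl fun n _ => ?_
  rw [zpow_sub₀ I_ne_zero, div_eq_mul_inv, ← zpow_neg, zpow_neg, ← inv_zpow, inv_I,
    ← conj_I, ← map_zpow₀, I_zpow_quatSeq hg hp4 hχ, I_zpow_quatSeq hg hp4 hχ]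
  push_cast
  rfl

/-- The `χ²` correlation gives the leading `-1`, and the two correlations of `χ` with `χ⁻¹` average
to the inner `-1`. The point masses at `v = 0` and `v = -w` give the factors `I` and `χ (-1)`, and
`J - J̄` leaves the imaginary part. -/
theorem autocorr_of_coe_ne_zero (hg : IsPrimitiveRoot g (p - 1)) (hp4 : 4 ∣ p - 1)
    (hχ : χ g = I) (h4 : orderOf χ = 4) {w : ℕ} (hw : (w : ZMod p) ≠ 0) :
    autocorr (2 * p) (quatSeq p g ![0, 2, 1, 3] ![2, 0, 3, 1]) w =
      -1 + sgn w * ((χ (-1) + I) * (χ w - I * χ⁻¹ w) - 1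
        - χ (-1) * χ w ^ 2 * (jacobiSum χ χ).im) := by
  classical
  rw [autocorr_eq_sum hg hp4 hχ]
  -- The inverses are kept in the shape `φ v * φ⁻¹ (v + w)` that `sum_mul_inv_shift` expects. The
  -- product of the two point masses is absent because `w` is nonzero mod `p`.
  have hpoint : ∀ v : ZMod p, phase χ 0 v * starRingEnd ℂ (phase χ w (v + w)) +
      phase χ 1 v * starRingEnd ℂ (phase χ (1 + w) (v + w)) =
      (χ ^ 2) v * (χ ^ 2)⁻¹ (v + w) + sgn w * (I / 2 * (χ v * χ (v + w)) +
        1 / 2 * (χ v * χ⁻¹ (v + w)) + 1 / 2 * (χ⁻¹ v * χ⁻¹⁻¹ (v + w)) -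
        I / 2 * (χ⁻¹ v * χ⁻¹ (v + w)) +
        (if v = 0 then I * (χ (v + w) - I * χ⁻¹ (v + w)) else 0) +
        if v = -w then χ v - I * χ⁻¹ v else 0) := by
    intro v
    rw [conj_phase h4, conj_phase h4, sq_inv_of_orderOf h4, inv_inv]
    simp only [phase, ← eq_neg_iff_add_eq_zero]
    generalize (χ ^ 2) v = e
    generalize (χ ^ 2) (v + w) = e'
    generalize χ v = a
    generalize χ (v + w) = a'
    generalize χ⁻¹ v = b
    generalize χ⁻¹ (v + w) = b'
    have h10 : (1 : ZMod 2) ≠ 0 := by decide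
    have h11 : (1 : ZMod 2) + 1 = 0 := by decide
    have hw2 : (w : ZMod 2) = 0 ∨ (w : ZMod 2) = 1 := by
      generalize (w : ZMod 2) = b; revert b; decide
    have hδ : ¬ (v = 0 ∧ v = -w) := by
      rintro ⟨rfl, h⟩
      exact hw (by simpa using h.symm)
    have hI := I_sq
    rcases hw2 with h | h <;> rw [h] <;> simp only [sgn, h10, h11, add_zero, if_true, if_false] <;>
      split_ifs <;> first | exact (hδ (And.intro (by assumption) (by assumption))).elim | grind
  have hχ1 := ne_one_of_orderOf h4
  have hneg : χ⁻¹ (-1) = χ (-1) := by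
    have h1 := apply_neg_one_mul_self χ
    have h2 := apply_mul_inv_apply χ (neg_ne_zero.mpr (one_ne_zero' (ZMod p)))
    linear_combination χ (-1) * h2 - χ⁻¹ (-1) * h1
  have hsq : χ⁻¹ (w : ZMod p) ^ 2 = χ w ^ 2 := by
    rw [← sq_apply, ← sq_apply, inv_pow, sq_inv_of_orderOf h4]
  have hmul : ∀ φ : MulChar (ZMod p) ℂ, φ (-w : ZMod p) = φ (-1) * φ w := fun φ => by
    rw [← map_mul, neg_one_mul]
  have hJ : jacobiSum χ χ - starRingEnd ℂ (jacobiSum χ χ) = 2 * (jacobiSum χ χ).im * I := by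
    rw [sub_conj]; push_cast; ring
  simp only [hpoint, sum_add_distrib, sum_sub_distrib, ← mul_sum, sum_ite_eq', mem_univ, if_true,
    zero_add, sum_mul_inv_shift (sq_ne_one_of_orderOf h4) hw, sum_mul_inv_shift hχ1 hw,
    sum_mul_inv_shift (inv_ne_one.mpr hχ1) hw]
  rw [sum_mul_shift χ χ hw, sum_mul_shift χ⁻¹ χ⁻¹ hw, conj_jacobiSum, hmul, hmul, hneg,
    ← sq, ← sq, hsq]
  linear_combination sgn w * (I / 2 * χ (-1) * χ w ^ 2 * hJ +
    (χ (-1) * χ w ^ 2 * (jacobiSum χ χ).im) * I_sq)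

/-- Here the shift only flips the parity. For `v ≠ 0` the two values differ by a factor `±i`, so the
two parities cancel; at `v = 0` the values `1` and `-1` give `-2`. -/
theorem autocorr_of_coe_eq_zero (hg : IsPrimitiveRoot g (p - 1)) (hp4 : 4 ∣ p - 1)
    (hχ : χ g = I) (h4 : orderOf χ = 4) {w : ℕ} (hw : (w : ZMod p) = 0) (hw2 : (w : ZMod 2) = 1) :
    autocorr (2 * p) (quatSeq p g ![0, 2, 1, 3] ![2, 0, 3, 1]) w = -2 := by
  classical
  have h11 : (1 : ZMod 2) + 1 = 0 := by decide
  rw [autocorr_eq_sum hg hp4 hχ, hw, hw2, h11,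
    ← show ∑ v : ZMod p, (if v = 0 then (-2 : ℂ) else 0) = -2 by simp]
  refine sum_congr rfl fun v _ => ?_
  rw [add_zero, conj_phase h4, conj_phase h4]
  simp only [phase, sgn]
  by_cases hv : v = 0
  · subst hv
    simp [MulChar.map_zero]
    norm_num
  · obtain ⟨c, hc⟩ := exists_apply_eq_I_pow hg hχ hv
    simp only [inv_apply_of_eq_I_pow hc, hc, hv, sq_apply]
    fin_cases c <;> simp [Complex.ext_iff, pow_succ] <;> norm_num

theorem apply_neg_one (hg : IsPrimitiveRoot g (p - 1)) (hχ : χ g = I) {k : ℕ}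
    (hk : p - 1 = 2 * k) : χ (-1) = I ^ k := by
  have hk0 : k ≠ 0 := by
    rintro rfl
    exact (Nat.sub_pos_of_lt (Fact.out : p.Prime).one_lt).ne' hk
  have h2 : IsPrimitiveRoot (g ^ k) 2 := hg.pow (by omega) (by rw [hk, mul_comm])
  rw [← h2.eq_neg_one_of_two_right, map_pow, hχ]

theorem exists_lt_two_mul (hcop : Nat.Coprime 2 p) (a : ZMod 2) (v : ZMod p) :
    ∃ w < 2 * p, (w : ZMod 2) = a ∧ (w : ZMod p) = v := by
  have hp0 := (Fact.out : p.Prime).ne_zero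
  obtain ⟨w, h1, h2⟩ := Nat.chineseRemainder hcop a.val v.val
  have := NeZero.mk hp0
  refine ⟨w % (2 * p), Nat.mod_lt _ (by positivity), ?_, ?_⟩
  · rw [← ZMod.natCast_zmod_val a, ZMod.natCast_eq_natCast_iff]
    exact (Nat.mod_modEq _ _).of_mul_right p |>.trans h1
  · rw [← ZMod.natCast_zmod_val v, ZMod.natCast_eq_natCast_iff]
    exact (Nat.mod_modEq _ _).of_mul_left 2 |>.trans h2

end Cyclotomic

/-! ### The table of values and its maximum. -/

section Maximum

variable {p : ℕ} [Fact p.Prime] {g : ZMod p}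

/-- The autocorrelation values, in terms of the quartic character `χ` with `χ g = i` and of
`n = Im J(χ, χ) / 2`. -/
theorem exists_autocorr_eq (hg : IsPrimitiveRoot g (p - 1)) (hp4 : 4 ∣ p - 1)
    {y : ℤ} (hy : ∀ a m : ℤ, Odd a → (p : ℤ) = a ^ 2 + (2 * m) ^ 2 → m ^ 2 = y ^ 2) :
    ∃ (χ : MulChar (ZMod p) ℂ) (n : ℤ), χ g = I ∧ (n = y ∨ n = -y) ∧
      (∀ w : ℕ, (w : ZMod p) ≠ 0 →
        autocorr (2 * p) (quatSeq p g ![0, 2, 1, 3] ![2, 0, 3, 1]) w =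
          -1 + sgn w * ((χ (-1) + I) * (χ w - I * χ⁻¹ w) - 1 - χ (-1) * χ w ^ 2 * (2 * n))) ∧
      ∀ w : ℕ, (w : ZMod p) = 0 → (w : ZMod 2) = 1 →
        autocorr (2 * p) (quatSeq p g ![0, 2, 1, 3] ![2, 0, 3, 1]) w = -2 := by
  obtain ⟨χ, hχ, h4⟩ := exists_quartic_character hg hp4
  have hchar : ringChar (ZMod p) ≠ 0 := by
    rw [ZMod.ringChar_zmod_n]; exact (Fact.out : p.Prime).ne_zero
  obtain ⟨a, m, hJ, ha, hcard⟩ := exists_jacobiSum_quartic h4 hchar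
  rw [ZMod.card] at hcard
  refine ⟨χ, -m, hχ, ?_, fun w hw => ?_, fun w hw hw2 =>
    autocorr_of_coe_eq_zero hg hp4 hχ h4 hw hw2⟩
  · rcases sq_eq_sq_iff_eq_or_eq_neg.mp (hy a m ha hcard) with h | h <;> simp [h]
  · rw [autocorr_of_coe_ne_zero hg hp4 hχ h4 hw, hJ]
    simp

theorem coe_two_eq_one_of_coe_eq_zero (hp4 : 4 ∣ p - 1) {w : ℕ} (h0 : 0 < w) (hlt : w < 2 * p)
    (hw : (w : ZMod p) = 0) : (w : ZMod 2) = 1 := by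
  rw [ZMod.natCast_eq_zero_iff] at hw
  obtain ⟨k, rfl⟩ := hw
  have hk : k = 1 := by
    have : k < 2 := by
      by_contra! h
      nlinarith
    have : k ≠ 0 := by
      rintro rfl
      simp at h0
    omega
  rw [hk, mul_one, natCast_zmod_two_eq_one hp4]

theorem sgn_eq_one_or (a : ZMod 2) : sgn a = 1 ∨ sgn a = -1 := by
  rw [sgn]
  split_ifs <;> simp

theorem norm_intCast_add_two_I (t : ℤ) {δ : ℤ} (hδ : δ = 1 ∨ δ = -1) :
    ‖((t : ℂ) + δ * (2 * I))‖ = √((t ^ 2 + 4 : ℤ) : ℝ) := by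
  rw [Complex.norm_def, normSq_apply]
  congr 1
  rcases hδ with rfl | rfl <;> simp <;> ring

theorem value_of_apply_neg_one_eq_neg_one {χ : MulChar (ZMod p) ℂ} (hneg : χ (-1) = -1)
    {v : ZMod p} {c : Fin 4} (hc : χ v = I ^ (c : ℕ)) (a : ZMod 2) (n : ℤ) :
    ∃ t ε δ : ℤ, (t = -2 ∨ t = 0) ∧ (ε = 1 ∨ ε = -1) ∧ (δ = 1 ∨ δ = -1) ∧
      -1 + sgn a * ((χ (-1) + I) * (χ v - I * χ⁻¹ v) - 1 - χ (-1) * χ v ^ 2 * (2 * n)) =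
        ((t + 2 * (ε * n) : ℤ) : ℂ) + δ * (2 * I) := by
  simp only [inv_apply_of_eq_I_pow hc, hc, hneg]
  rcases sgn_eq_one_or a with h | h <;> rw [h] <;> fin_cases c
  · exact ⟨-2, 1, 1, by simp, by simp, by simp, by simp [Complex.ext_iff]; ring_nf; simp⟩
  · exact ⟨-2, -1, -1, by simp, by simp, by simp, by simp [Complex.ext_iff, pow_succ]; ring_nf; simp⟩
  · exact ⟨-2, 1, -1, by simp, by simp, by simp, by simp [Complex.ext_iff, pow_succ]; ring_nf; simp⟩
  · exact ⟨-2, -1, 1, by simp, by simp, by simp, by simp [Complex.ext_iff, pow_succ]; ring_nf; simp⟩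
  · exact ⟨0, -1, -1, by simp, by simp, by simp, by simp [Complex.ext_iff]; ring_nf⟩
  · exact ⟨0, 1, 1, by simp, by simp, by simp, by simp [Complex.ext_iff, pow_succ]; ring_nf⟩
  · exact ⟨0, -1, 1, by simp, by simp, by simp, by simp [Complex.ext_iff, pow_succ]; ring_nf⟩
  · exact ⟨0, 1, -1, by simp, by simp, by simp, by simp [Complex.ext_iff, pow_succ]; ring_nf⟩

theorem value_of_apply_neg_one_eq_one {χ : MulChar (ZMod p) ℂ} (hneg : χ (-1) = 1)
    {v : ZMod p} {c : Fin 4} (hc : χ v = I ^ (c : ℕ)) (a : ZMod 2) (n : ℤ) :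
    ∃ t ε : ℤ, |t| ≤ 4 ∧ (ε = 1 ∨ ε = -1) ∧
      -1 + sgn a * ((χ (-1) + I) * (χ v - I * χ⁻¹ v) - 1 - χ (-1) * χ v ^ 2 * (2 * n)) =
        ((t + 2 * (ε * n) : ℤ) : ℂ) := by
  simp only [inv_apply_of_eq_I_pow hc, hc, hneg]
  rcases sgn_eq_one_or a with h | h <;> rw [h] <;> fin_cases c
  · exact ⟨0, -1, by simp, by simp, by simp [Complex.ext_iff]; ring⟩
  · exact ⟨-4, 1, by simp, by simp, by simp [Complex.ext_iff]; ring⟩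
  · exact ⟨-4, -1, by simp, by simp, by simp [Complex.ext_iff]; ring⟩
  · exact ⟨0, 1, by simp, by simp, by simp [Complex.ext_iff, pow_succ]⟩
  · exact ⟨-2, 1, by simp, by simp, by simp [Complex.ext_iff]; ring⟩
  · exact ⟨2, -1, by simp, by simp, by simp [Complex.ext_iff]; ring⟩
  · exact ⟨2, 1, by simp, by simp, by simp [Complex.ext_iff]; ring⟩
  · exact ⟨-2, -1, by simp, by simp, by simp [Complex.ext_iff, pow_succ]; ring⟩

theorem abs_add_two_mul_le {t ε n y b : ℤ} (ht : |t| ≤ b) (hε : ε = 1 ∨ ε = -1)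
    (hn : n = y ∨ n = -y) : |t + 2 * (ε * n)| ≤ b + 2 * |y| := by
  have hn' : |n| = |y| := by rcases hn with rfl | rfl <;> simp
  have hε' : |ε| = 1 := by rcases hε with rfl | rfl <;> simp
  calc |t + 2 * (ε * n)| ≤ |t| + |2 * (ε * n)| := abs_add_le _ _
    _ = |t| + 2 * |y| := by rw [abs_mul, abs_mul, hn', hε', one_mul]; norm_num
    _ ≤ b + 2 * |y| := by gcongr

theorem exists_sign_abs {b : ℤ} (hb : 0 ≤ b) (n : ℤ) :
    ∃ ε : ℤ, (ε = 1 ∨ ε = -1) ∧ |-b + 2 * (ε * n)| = b + 2 * |n| := by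
  rcases le_total 0 n with h | h
  · refine ⟨-1, by simp, ?_⟩
    rw [abs_of_nonneg h, abs_of_nonpos] <;> linarith
  · refine ⟨1, by simp, ?_⟩
    rw [abs_of_nonpos h, abs_of_nonpos] <;> linarith

/-- Every `χ`-value `i ^ c` occurs at an even nonzero shift. -/
theorem exists_even_shift (hg : IsPrimitiveRoot g (p - 1)) (hp4 : 4 ∣ p - 1)
    {χ : MulChar (ZMod p) ℂ} (hχ : χ g = I) (c : ℕ) :
    ∃ w : ℕ, 0 < w ∧ w < 2 * p ∧ (w : ZMod p) ≠ 0 ∧ sgn w = 1 ∧ χ w = I ^ c := by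
  have hg0 : g ≠ 0 :=
    (hg.isUnit (Nat.sub_pos_of_lt (Fact.out : p.Prime).one_lt).ne').ne_zero
  obtain ⟨w, hw, h2, hwp⟩ := exists_lt_two_mul (coprime_two_of_dvd hp4) 0 (g ^ c)
  have hne : (w : ZMod p) ≠ 0 := hwp ▸ pow_ne_zero c hg0
  refine ⟨w, Nat.pos_of_ne_zero ?_, hw, hne, by simp [sgn, h2], by rw [hwp, map_pow, hχ]⟩
  rintro rfl
  simp at hne

theorem isGreatest_magnitudes_five (hg : IsPrimitiveRoot g (p - 1)) (hp8 : p % 8 = 5)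
    {y : ℤ} (hy : ∀ a m : ℤ, Odd a → (p : ℤ) = a ^ 2 + (2 * m) ^ 2 → m ^ 2 = y ^ 2) :
    IsGreatest (nontrivialMagnitudes (2 * p) (quatSeq p g ![0, 2, 1, 3] ![2, 0, 3, 1]))
      √(((2 + 2 * |y|) ^ 2 + 4 : ℤ) : ℝ) := by
  have hp4 : 4 ∣ p - 1 := by omega
  obtain ⟨χ, n, hχ, hn, hR, hR0⟩ := exists_autocorr_eq hg hp4 hy
  have hneg : χ (-1) = -1 := by
    rw [apply_neg_one hg hχ (show p - 1 = 2 * (4 * (p / 8) + 2) by omega), pow_add, pow_mul]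
    simp
  constructor
  · have hattain : ∀ ε : ℤ, ε = 1 ∨ ε = -1 → ∃ (w : ℕ) (δ : ℤ), (δ = 1 ∨ δ = -1) ∧ 0 < w ∧
        w < 2 * p ∧ autocorr (2 * p) (quatSeq p g ![0, 2, 1, 3] ![2, 0, 3, 1]) w =
          ((-2 + 2 * (ε * n) : ℤ) : ℂ) + δ * (2 * I) := by
      rintro ε (rfl | rfl)
      -- `χ w = 1` and `χ w = i` have opposite `χ w ^ 2`, hence give both signs of `n`.
      · obtain ⟨w, h0, hlt, hw, hs, hc⟩ := exists_even_shift hg hp4 hχ 0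
        refine ⟨w, 1, by simp, h0, hlt, ?_⟩
        rw [hR w hw, hs, inv_apply_of_eq_I_pow (c := 0) hc, hc, hneg]
        simp [Complex.ext_iff]
        ring_nf
        simp
      · obtain ⟨w, h0, hlt, hw, hs, hc⟩ := exists_even_shift hg hp4 hχ 1
        refine ⟨w, -1, by simp, h0, hlt, ?_⟩
        rw [hR w hw, hs, inv_apply_of_eq_I_pow (c := 1) hc, hc, hneg]
        simp [Complex.ext_iff]
        ring_nf
        simp
    obtain ⟨ε, hε, habs⟩ := exists_sign_abs (by norm_num : (0 : ℤ) ≤ 2) n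
    obtain ⟨w, δ, hδ, h0, hlt, hw⟩ := hattain ε hε
    refine ⟨w, h0, hlt, ?_⟩
    have hny : |n| = |y| := by rcases hn with rfl | rfl <;> simp
    rw [hw, norm_intCast_add_two_I _ hδ, ← sq_abs (-2 + 2 * (ε * n)), habs, hny]
  · rintro _ ⟨w, h0, hlt, rfl⟩
    by_cases hw : (w : ZMod p) = 0
    · rw [hR0 w hw (coe_two_eq_one_of_coe_eq_zero hp4 h0 hlt hw)]
      apply Real.le_sqrt_of_sq_le
      norm_num
      positivity
    · obtain ⟨c, hc⟩ := exists_apply_eq_I_pow hg hχ hw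
      obtain ⟨t, ε, δ, ht, hε, hδ, h⟩ := value_of_apply_neg_one_eq_neg_one hneg hc w n
      rw [hR w hw, h, norm_intCast_add_two_I _ hδ]
      apply Real.sqrt_le_sqrt
      have ht' : |t| ≤ 2 := by rcases ht with rfl | rfl <;> norm_num
      have := pow_le_pow_left₀ (abs_nonneg _) (abs_add_two_mul_le ht' hε hn) 2
      rw [sq_abs] at this
      exact_mod_cast add_le_add_left this 4

theorem isGreatest_magnitudes_one (hg : IsPrimitiveRoot g (p - 1)) (hp8 : p % 8 = 1)
    {y : ℤ} (hy : ∀ a m : ℤ, Odd a → (p : ℤ) = a ^ 2 + (2 * m) ^ 2 → m ^ 2 = y ^ 2) :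
    IsGreatest (nontrivialMagnitudes (2 * p) (quatSeq p g ![0, 2, 1, 3] ![2, 0, 3, 1]))
      ((4 + 2 * |y| : ℤ) : ℝ) := by
  have hp4 : 4 ∣ p - 1 := by omega
  obtain ⟨χ, n, hχ, hn, hR, hR0⟩ := exists_autocorr_eq hg hp4 hy
  have hneg : χ (-1) = 1 := by
    rw [apply_neg_one hg hχ (show p - 1 = 2 * (4 * (p / 8)) by omega), pow_mul]
    simp
  constructor
  · have hattain : ∀ ε : ℤ, ε = 1 ∨ ε = -1 → ∃ w : ℕ, 0 < w ∧
        w < 2 * p ∧ autocorr (2 * p) (quatSeq p g ![0, 2, 1, 3] ![2, 0, 3, 1]) w =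
          ((-4 + 2 * (ε * n) : ℤ) : ℂ) := by
      rintro ε (rfl | rfl)
      -- At even shifts the constant `-4` occurs exactly for `χ w = i` and `χ w = -1`, once with
      -- each sign of `n`.
      · obtain ⟨w, h0, hlt, hw, hs, hc⟩ := exists_even_shift hg hp4 hχ 1
        refine ⟨w, h0, hlt, ?_⟩
        rw [hR w hw, hs, inv_apply_of_eq_I_pow (c := 1) hc, hc, hneg]
        simp [Complex.ext_iff]
        ring
      · obtain ⟨w, h0, hlt, hw, hs, hc⟩ := exists_even_shift hg hp4 hχ 2
        refine ⟨w, h0, hlt, ?_⟩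
        rw [hR w hw, hs, inv_apply_of_eq_I_pow (c := 2) hc, hc, hneg]
        simp [Complex.ext_iff]
        ring
    obtain ⟨ε, hε, habs⟩ := exists_sign_abs (by norm_num : (0 : ℤ) ≤ 4) n
    obtain ⟨w, h0, hlt, hw⟩ := hattain ε hε
    refine ⟨w, h0, hlt, ?_⟩
    have hny : |n| = |y| := by rcases hn with rfl | rfl <;> simp
    rw [hw, Complex.norm_intCast, ← Int.cast_abs, habs, hny]
  · rintro _ ⟨w, h0, hlt, rfl⟩
    by_cases hw : (w : ZMod p) = 0
    · rw [hR0 w hw (coe_two_eq_one_of_coe_eq_zero hp4 h0 hlt hw)]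
      have : (2 : ℤ) ≤ 4 + 2 * |y| := by linarith [abs_nonneg y]
      have : (2 : ℝ) ≤ ((4 + 2 * |y| : ℤ) : ℝ) := by exact_mod_cast this
      simpa using this
    · obtain ⟨c, hc⟩ := exists_apply_eq_I_pow hg hχ hw
      obtain ⟨t, ε, ht, hε, h⟩ := value_of_apply_neg_one_eq_one hneg hc w n
      rw [hR w hw, h, Complex.norm_intCast]
      exact_mod_cast abs_add_two_mul_le ht hε hn

end Maximum

end QuaternaryCyclotomic

/-! ### Comparison with the maxima over signs. -/

theorem lemma3 (p : ℕ) (hp : p.Prime) (g : ZMod p) (hg : IsPrimitiveRoot g (p - 1))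
    (x y : ℤ) (hxy : (p : ℤ) = x ^ 2 + 4 * y ^ 2) (hx : x ≡ 1 [ZMOD 4]) :
    (p ≡ 5 [MOD 8] →
      ∃ M : ℝ,
        IsGreatest (QuaternaryCyclotomic.nontrivialMagnitudes (2 * p)
          (QuaternaryCyclotomic.quatSeq p g ![0, 2, 1, 3] ![2, 0, 3, 1])) M ∧
        IsGreatest {r : ℝ | ∃ ε δ : ℤ, (ε = 1 ∨ ε = -1) ∧ (δ = 1 ∨ δ = -1) ∧
          r = ‖(-2 + (ε : ℂ) * (2 * (y : ℂ)) + (δ : ℂ) * (2 * Complex.I) : ℂ)‖} M) ∧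
    (p ≡ 1 [MOD 8] →
      ∃ M : ℝ,
        IsGreatest (QuaternaryCyclotomic.nontrivialMagnitudes (2 * p)
          (QuaternaryCyclotomic.quatSeq p g ![0, 2, 1, 3] ![2, 0, 3, 1])) M ∧
        IsGreatest {r : ℝ | ∃ ε : ℤ, (ε = 1 ∨ ε = -1) ∧
          r = |(-4 + (ε : ℝ) * (2 * (y : ℝ)) : ℝ)|} M) := by
  have := Fact.mk hp
  have hxodd : Odd x := by
    rw [Int.odd_iff]
    have : x % 4 = 1 := hx
    omega
  have hy : ∀ a m : ℤ, Odd a → (p : ℤ) = a ^ 2 + (2 * m) ^ 2 → m ^ 2 = y ^ 2 := by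
    intro a m ha h
    have h' : (p : ℤ) = x ^ 2 + (2 * y) ^ 2 := by rw [hxy]; ring
    have := QuaternaryCyclotomic.even_sq_eq_of_sum_two_squares hp h' h hxodd ha (even_two_mul y)
    linarith
  refine ⟨fun hp8 => ⟨_, QuaternaryCyclotomic.isGreatest_magnitudes_five hg hp8 hy, ?_, ?_⟩,
    fun hp8 => ⟨_, QuaternaryCyclotomic.isGreatest_magnitudes_one hg hp8 hy, ?_, ?_⟩⟩
  -- The maximum over signs occurs when `ε y ≤ 0`; the sign of `2i` does not affect the norm.
  · obtain ⟨ε, hε, habs⟩ := QuaternaryCyclotomic.exists_sign_abs (by norm_num : (0 : ℤ) ≤ 2) y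
    refine ⟨ε, 1, hε, Or.inl rfl, ?_⟩
    rw [← habs, sq_abs, ← QuaternaryCyclotomic.norm_intCast_add_two_I _ (Or.inl rfl)]
    congr 1
    push_cast
    ring
  · rintro _ ⟨ε, δ, hε, hδ, rfl⟩
    have hcast : (-2 + (ε : ℂ) * (2 * (y : ℂ)) + (δ : ℂ) * (2 * Complex.I) : ℂ) =
        ((-2 + 2 * (ε * y) : ℤ) : ℂ) + δ * (2 * Complex.I) := by
      push_cast
      ring
    rw [hcast, QuaternaryCyclotomic.norm_intCast_add_two_I _ hδ]
    apply Real.sqrt_le_sqrt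
    have habs := QuaternaryCyclotomic.abs_add_two_mul_le (t := -2) (b := 2) (by norm_num) hε
      (Or.inl (rfl : y = y))
    have := pow_le_pow_left₀ (abs_nonneg _) habs 2
    rw [sq_abs] at this
    exact_mod_cast add_le_add_left this 4
  · obtain ⟨ε, hε, habs⟩ := QuaternaryCyclotomic.exists_sign_abs (by norm_num : (0 : ℤ) ≤ 4) y
    refine ⟨ε, hε, ?_⟩
    rw [← habs]
    push_cast
    congr 1
    ring
  · rintro _ ⟨ε, hε, rfl⟩
    have habs := QuaternaryCyclotomic.abs_add_two_mul_le (t := -4) (b := 4) (by norm_num) hε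
      (Or.inl (rfl : y = y))
    have hcast : (-4 + (ε : ℝ) * (2 * (y : ℝ)) : ℝ) = ((-4 + 2 * (ε * y) : ℤ) : ℝ) := by
      push_cast
      ring
    rw [hcast, ← Int.cast_abs]
    exact_mod_cast habs
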